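/- Let $\mathcal R=\langle R;<,+,\dots\rangle$ be an o-minimal expansion of an ordered group, and let $\mathcal M=\langle R;+,\dots\rangle$ be a reduct of $\mathcal R$ (that is, $\mathcal M$ has universe $R$ and every subset of $R^n$ definable with parameters in $\mathcal M$ is definable with parameters in $\mathcal R$; addition is $\emptyset$-definable in $\mathcal M$). Assume that 1. $\mathcal M$ is strongly bounded: every subset $X\subseteq R$ definable in $\mathcal M$ with parameters is bounded or co-bounded (i.e. $R\setminus X$ is bounded) with respect to $<$; 2. $\operatorname{acl}_{\mathcal M}(\emptyset)$ contains a nonzero element; 3. for all $a,b\in\operatorname{acl}_{\mathcal M}(\emptyset)$, the restriction of $<$ to the interval $(a,b)\subseteq R$ is $\emptyset$-definable in $\mathcal M$. Then every endomorphism $f$ of $\langle R,+\rangle$ whose graph is definable in $\mathcal M$ with parameters is $\emptyset$-definable in $\mathcal M$. Moreover, every family $\{f_t:t\in T\}$ of endomorphisms of $\langle R,+\rangle$ (with $T\subseteq R^k$) that is definable in $\mathcal M$ with parameters consists of only finitely many distinct endomorphisms. -/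

import Mathlib

namespace StronglyBounded

universe u v u' v' w

section Structures

variable (L : FirstOrder.Language.{u, v}) (L' : FirstOrder.Language.{u', v'}) (R : Type w)

/-- The first structure on `R` (language `L`) is a reduct of the second one (language `L'`):
every subset of a finite power of `R` that is definable in the first with parameters is
definable in the second with parameters. -/
def IsReduct [L.Structure R] [L'.Structure R] : Prop :=
  ∀ (n : ℕ) (X : Set (Fin n → R)),
    (Set.univ : Set R).Definable L X → (Set.univ : Set R).Definable L' X

/-- The graph of the addition of `R` is definable in the `L`-structure without parameters
(in particular this holds if addition is a symbol of `L`). -/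
def ExpandsAdd [L.Structure R] [Add R] : Prop :=
  (∅ : Set R).Definable L {x : Fin 3 → R | x 0 + x 1 = x 2}

/-- The order of `R` is definable in the `L`-structure without parameters
(in particular this holds if the order is a symbol of `L`). -/
def ExpandsLT [L.Structure R] [LT R] : Prop :=
  (∅ : Set R).Definable₂ L {p : R × R | p.1 < p.2}

/-- A point, or an open interval with endpoints in `R ∪ {-∞, +∞}`. -/
def IsPointOrInterval {R : Type w} [LinearOrder R] (J : Set R) : Prop :=
  (∃ a, J = {a}) ∨ (∃ a b, J = Set.Ioo a b) ∨ (∃ a, J = Set.Ioi a) ∨ (∃ b, J = Set.Iio b) ∨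
    J = Set.univ

/-- O-minimality of a structure with respect to the linear order of `R`, which is required to be
definable in it: every subset of `R` definable with parameters is a finite union of points and
open intervals. -/
structure IsOMinimal [L.Structure R] [LinearOrder R] : Prop where
  expandsLT : ExpandsLT L R
  finite_union : ∀ X : Set R, (Set.univ : Set R).Definable₁ L X →
    ∃ S : Set (Set R), S.Finite ∧ (∀ J ∈ S, IsPointOrInterval J) ∧ X = ⋃₀ S

/-- Every subset of `R` definable with parameters is bounded or co-bounded. -/
def IsStronglyBounded [L.Structure R] [LinearOrder R] : Prop :=
  ∀ X : Set R, (Set.univ : Set R).Definable₁ L X →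
    (BddBelow X ∧ BddAbove X) ∨ (BddBelow Xᶜ ∧ BddAbove Xᶜ)

variable {R}

/-- The model theoretic algebraic closure of `A`: the union of all finite `A`-definable subsets
of `R`. -/
def acl [L.Structure R] (A : Set R) : Set R :=
  {a | ∃ X : Set R, X.Finite ∧ A.Definable₁ L X ∧ a ∈ X}

variable (R) in
/-- For every interval `(a, b)` with `a, b ∈ acl(∅)`, the restriction of `<` to `(a, b)` is
definable without parameters. -/
def OrderDefinableOnEmptyIntervals [L.Structure R] [LinearOrder R] : Prop :=
  ∀ a ∈ acl L (∅ : Set R), ∀ b ∈ acl L (∅ : Set R),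
    (∅ : Set R).Definable₂ L
      {p : R × R | p.1 ∈ Set.Ioo a b ∧ p.2 ∈ Set.Ioo a b ∧ p.1 < p.2}

/-- The endomorphism `f` of the group `R` has a graph that is definable over `A`. -/
def EndDefinable [L.Structure R] [AddGroup R] (A : Set R) (f : R →+ R) : Prop :=
  A.Definable₂ L {p : R × R | f p.1 = p.2}

/-- `(f t)` for `t ∈ T`, with `T ⊆ R^k` definable, is a family of endomorphisms of the group `R`
that is definable with parameters: `T` and the set of all `(t, x, y)` with `t ∈ T` and
`f t x = y` are definable. -/
def EndFamilyDefinable [L.Structure R] [AddGroup R] {k : ℕ} (T : Set (Fin k → R))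
    (f : T → (R →+ R)) : Prop :=
  (Set.univ : Set R).Definable L T ∧
    (Set.univ : Set R).Definable L
      {z : Fin k ⊕ Fin 2 → R | ∃ t : T, (∀ i, z (Sum.inl i) = (t : Fin k → R) i) ∧
        f t (z (Sum.inr 0)) = z (Sum.inr 1)}

end Structures

end StronglyBounded

/-!
Fix a positive `c ∈ acl(∅)`. In an o-minimal ordered
group every nonzero definable subgroup is the whole group (`IsOMinimal.addSubgroup_eq_top`). So the
group is commutative, a definable endomorphism is determined by its value at `c`, a nonzero one is
surjective, and one that is positive at `c` is strictly increasing (`EndDefinable.strictMono`).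

Let `f t`, `t ∈ T`, be a family of endomorphisms definable in the strongly bounded structure, and
let `Y` be the set of all `h⁻¹ c`, where `h = f t - f s` and `0 < h c < c`. The interval `(0, c)` is
definable in that structure, hence so is `Y`; its elements are positive, so it is not co-bounded and
must have an upper bound `K`. Then `h K ≥ c` for all these `h`. If the family were infinite, the set
of values `f t c` would contain an interval, which may be taken shorter than `c`. For the
corresponding `t`, the values `f t K` would form an infinite definable set whose distinct elements
are at distance at least `c`, contradicting o-minimality (`finite_range_of_definable_family`).

For a single endomorphism `f` definable with parameters, quantify over the parameters: `f` is a
member of a `∅`-definable family of endomorphisms, which is finite. Hence `f c ∈ acl(∅)`. A finite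
`∅`-definable set lies in an interval with endpoints in `acl(∅)`, on which the order is
`∅`-definable, so its elements are themselves `∅`-definable (`definable_singleton_of_mem_acl`). Thus
`f`, being the only member of the family that takes the `∅`-definable value `f c` at the
`∅`-definable point `c`, is `∅`-definable (`EndDefinable.definable_empty`).
-/

namespace StronglyBounded

open Set FirstOrder

/-! ### Closure properties of definability -/

section Definability

variable {L : Language} {R : Type*} [L.Structure R] {A : Set R} {α β : Type*}

theorem definable_and {P Q : (α → R) → Prop} (hP : A.Definable L {v | P v})
    (hQ : A.Definable L {v | Q v}) : A.Definable L {v | P v ∧ Q v} :=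
  hP.inter hQ

theorem definable_or {P Q : (α → R) → Prop} (hP : A.Definable L {v | P v})
    (hQ : A.Definable L {v | Q v}) : A.Definable L {v | P v ∨ Q v} :=
  hP.union hQ

theorem definable_not {P : (α → R) → Prop} (hP : A.Definable L {v | P v}) :
    A.Definable L {v | ¬ P v} :=
  hP.compl

theorem definable_imp {P Q : (α → R) → Prop} (hP : A.Definable L {v | P v})
    (hQ : A.Definable L {v | Q v}) : A.Definable L {v | P v → Q v} := by
  simpa only [imp_iff_not_or] using definable_or (definable_not hP) hQ

theorem definable_exists_tuple [Finite β] {P : (α → R) → (β → R) → Prop}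
    (h : A.Definable L {w : α ⊕ β → R | P (fun i => w (.inl i)) (fun j => w (.inr j))}) :
    A.Definable L {v | ∃ u, P v u} :=
  h.exists_of_finite

theorem definable_exists {P : (α → R) → R → Prop}
    (h : A.Definable L {w : α ⊕ Fin 1 → R | P (fun i => w (.inl i)) (w (.inr 0))}) :
    A.Definable L {v | ∃ x, P v x} := by
  convert definable_exists_tuple (β := Fin 1) (P := fun v u => P v (u 0)) h using 3 with v
  exact ⟨fun ⟨x, hx⟩ => ⟨fun _ => x, hx⟩, fun ⟨u, hu⟩ => ⟨u 0, hu⟩⟩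

theorem definable_forall {P : (α → R) → R → Prop}
    (h : A.Definable L {w : α ⊕ Fin 1 → R | P (fun i => w (.inl i)) (w (.inr 0))}) :
    A.Definable L {v | ∀ x, P v x} := by
  simpa only [not_exists, not_not] using
    definable_not (definable_exists (P := fun v x => ¬ P v x) (definable_not h))

theorem definable_mem {X : Set R} (hX : A.Definable₁ L X) {F : (α → R) → R}
    (hF : A.DefinableFun L F) : A.Definable L {v | F v ∈ X} :=
  Set.Definable.preimage_map (F := fun v (_ : Fin 1) => F v) (fun _ => hF) hX

theorem definable_mem_pair {X : Set (R × R)} (hX : A.Definable₂ L X) {F G : (α → R) → R}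
    (hF : A.DefinableFun L F) (hG : A.DefinableFun L G) :
    A.Definable L {v | (F v, G v) ∈ X} := by
  refine Set.Definable.preimage_map (F := fun v => ![F v, G v]) (fun i => ?_) hX
  fin_cases i <;> simpa

theorem definableFun_add [Add R] (hadd : ExpandsAdd L R) {F G : (α → R) → R}
    (hF : A.DefinableFun L F) (hG : A.DefinableFun L G) :
    A.DefinableFun L fun v => F v + G v := by
  have h : A.DefinableFun L (fun v : Fin 2 → R => v 0 + v 1) :=
    (hadd.mono (empty_subset A)).preimage_comp ![some 0, some 1, none]
  refine DefinableFun.comp (g := fun v => ![F v, G v]) (fun i => ?_) h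
  fin_cases i <;> simpa

theorem definableFun_rename {F : (α → R) → R} (hF : A.DefinableFun L F) (e : α → β) :
    A.DefinableFun L fun w : β → R => F (fun i => w (e i)) := by
  have := hF.preimage_comp (fun i : Option α => i.map e)
  exact this

theorem definableFun_sub [AddGroup R] (hadd : ExpandsAdd L R) {F G : (α → R) → R}
    (hF : A.DefinableFun L F) (hG : A.DefinableFun L G) :
    A.DefinableFun L fun v => F v - G v := by
  have := (definableFun_rename hF some).ofPred_eq
    (definableFun_add hadd (.proj L (i := none)) (definableFun_rename hG some))
  simpa only [DefinableFun, Function.tupleGraph, sub_eq_iff_eq_add] using! this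

theorem definable_lt [LT R] (hlt : ExpandsLT L R) {F G : (α → R) → R}
    (hF : A.DefinableFun L F) (hG : A.DefinableFun L G) :
    A.Definable L {v | F v < G v} :=
  definable_mem_pair (hlt.mono (empty_subset A)) hF hG

theorem definable_le [LinearOrder R] (hlt : ExpandsLT L R) {F G : (α → R) → R}
    (hF : A.DefinableFun L F) (hG : A.DefinableFun L G) :
    A.Definable L {v | F v ≤ G v} := by
  simpa only [not_lt] using definable_not (definable_lt hlt hG hF)

theorem definableFun_const {a : R} : (univ : Set R).DefinableFun L (fun _ : α → R => a) :=
  L.definableFun_const α (mem_univ a)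

/-- A definable endomorphism, applied to a definable function, is a definable function. -/
theorem EndDefinable.comp [AddGroup R] {f : R →+ R} (hf : EndDefinable L A f)
    {F : (α → R) → R} (hF : A.DefinableFun L F) : A.DefinableFun L fun v => f (F v) := by
  have h : A.DefinableFun L (fun v : Fin 1 → R => f (v 0)) := hf.preimage_comp ![some 0, none]
  exact DefinableFun.comp (g := fun v _ => F v) (fun _ => hF) h

/-- Definability with parameters in a reduct passes to the full structure for sets of tuples
indexed by any finite type, not only by `Fin n`. -/
theorem IsReduct.definable {L' : Language} [L'.Structure R] (h : IsReduct L L' R) [Finite α]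
    {X : Set (α → R)} (hX : (univ : Set R).Definable L X) : (univ : Set R).Definable L' X := by
  obtain ⟨n, ⟨e⟩⟩ := Finite.exists_equiv_fin α
  have := (h n _ (hX.preimage_comp e)).preimage_comp e.symm
  convert this using 1
  ext v
  simp [Function.comp_def]

end Definability

/-! ### Definable sets in o-minimal ordered groups -/

theorem IsPointOrInterval.ordConnected {R : Type*} [LinearOrder R] {J : Set R}
    (hJ : IsPointOrInterval J) : J.OrdConnected := by
  rcases hJ with ⟨a, rfl⟩ | ⟨a, b, rfl⟩ | ⟨a, rfl⟩ | ⟨b, rfl⟩ | rfl <;> infer_instance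

section LinearOrder

variable {L : Language} {R : Type*} [L.Structure R] [LinearOrder R]

theorem IsOMinimal.exists_Icc_subset (H : IsOMinimal L R) {X : Set R}
    (hX : (univ : Set R).Definable₁ L X) (hinf : X.Infinite) :
    ∃ x y, x < y ∧ Icc x y ⊆ X := by
  obtain ⟨S, hS, hJ, rfl⟩ := H.finite_union X hX
  obtain ⟨J, hJS, hJinf⟩ : ∃ J ∈ S, J.Infinite := by
    by_contra! h
    exact hinf (hS.sUnion fun J hJ => h J hJ)
  obtain ⟨x, hx, y, hy, hxy⟩ := hJinf.nontrivial.exists_lt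
  exact ⟨x, y, hxy, ((hJ J hJS).ordConnected.out hx hy).trans (subset_sUnion_of_mem hJS)⟩

/-- A definable set contains, or is disjoint from, a whole interval to the right of any point. -/
theorem IsOMinimal.exists_Ioo_subset_or_disjoint (H : IsOMinimal L R) [NoMaxOrder R] {X : Set R}
    (hX : (univ : Set R).Definable₁ L X) (a : R) :
    ∃ b, a < b ∧ (Ioo a b ⊆ X ∨ Disjoint (Ioo a b) X) := by
  obtain ⟨S, hS, hJ, rfl⟩ := H.finite_union X hX
  clear hX
  induction S, hS using Set.Finite.induction_on with
  | empty =>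
    obtain ⟨b, hb⟩ := exists_gt a
    exact ⟨b, hb, by simp⟩
  | @insert J S _ _ ih =>
    obtain ⟨b, hab, hb⟩ := ih fun J hJS => hJ J (mem_insert_of_mem _ hJS)
    rw [sUnion_insert]
    obtain hb | hb := hb
    · exact ⟨b, hab, Or.inl (hb.trans subset_union_right)⟩
    by_cases h : ∃ d, a < d ∧ Disjoint (Ioo a d) J
    · obtain ⟨d, had, hd⟩ := h
      refine ⟨min b d, lt_min hab had, Or.inr (disjoint_union_right.2 ⟨?_, ?_⟩)⟩
      · exact hd.mono_left (Ioo_subset_Ioo_right (min_le_right _ _))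
      · exact hb.mono_left (Ioo_subset_Ioo_right (min_le_left _ _))
    · -- The convex set `J` has points arbitrarily close to `a` on the right.
      push Not at h
      obtain ⟨y, hy, hyJ⟩ := not_disjoint_iff.1 (h b hab)
      refine ⟨y, hy.1, Or.inl fun x hx => Or.inl ?_⟩
      obtain ⟨z, hz, hzJ⟩ := not_disjoint_iff.1 (h x hx.1)
      exact (hJ J (mem_insert _ _)).ordConnected.out hzJ hyJ ⟨hz.2.le, hx.2.le⟩

theorem IsPointOrInterval.exists_isLUB [DenselyOrdered R] [NoMaxOrder R] {J : Set R}
    (hJ : IsPointOrInterval J) (hne : J.Nonempty) (hbdd : BddAbove J) : ∃ s, IsLUB J s := by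
  rcases hJ with ⟨a, rfl⟩ | ⟨a, b, rfl⟩ | ⟨a, rfl⟩ | ⟨b, rfl⟩ | rfl
  · exact ⟨a, isLUB_singleton⟩
  · exact ⟨b, isLUB_Ioo (nonempty_Ioo.1 hne)⟩
  · exact (not_bddAbove_Ioi a hbdd).elim
  · refine ⟨b, fun x hx => le_of_lt hx, fun u hu => le_of_not_gt fun hub => ?_⟩
    obtain ⟨z, hz, hzb⟩ := exists_between hub
    exact (hu hzb).not_gt hz
  · have : Nonempty R := hne.to_type
    exact (not_bddAbove_univ hbdd).elim

/-- Definable completeness. -/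
theorem IsOMinimal.exists_isLUB (H : IsOMinimal L R) [DenselyOrdered R] [NoMaxOrder R] {X : Set R}
    (hX : (univ : Set R).Definable₁ L X) (hne : X.Nonempty) (hbdd : BddAbove X) :
    ∃ s, IsLUB X s := by
  obtain ⟨S, hS, hJ, rfl⟩ := H.finite_union X hX
  clear hX
  induction S, hS using Set.Finite.induction_on with
  | empty => simp at hne
  | @insert J S _ _ ih =>
    have ih := ih fun J hJS => hJ J (mem_insert_of_mem _ hJS)
    rw [sUnion_insert] at hne hbdd ⊢
    rw [bddAbove_union] at hbdd
    rcases J.eq_empty_or_nonempty with rfl | hJne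
    · simpa using ih (by simpa using hne) hbdd.2
    obtain ⟨s, hs⟩ := (hJ J (mem_insert _ _)).exists_isLUB hJne hbdd.1
    rcases (⋃₀ S).eq_empty_or_nonempty with hS | hS
    · exact ⟨s, by simpa only [hS, union_empty] using hs⟩
    obtain ⟨t, ht⟩ := ih hS hbdd.2
    exact ⟨s ⊔ t, hs.union ht⟩

end LinearOrder

theorem noMaxOrder_of_nontrivial {R : Type*} [AddGroup R] [LinearOrder R] [AddLeftMono R]
    [Nontrivial R] : NoMaxOrder R := by
  obtain ⟨c, hc⟩ : ∃ c : R, 0 < c := by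
    obtain ⟨c, hc⟩ := exists_ne (0 : R)
    rcases hc.lt_or_gt with h | h
    · exact ⟨-c, neg_pos.2 h⟩
    · exact ⟨c, h⟩
  exact ⟨fun x => ⟨x + c, lt_add_of_pos_right x hc⟩⟩

section AddGroup

variable {L : Language} {R : Type*} [L.Structure R] [AddGroup R] [LinearOrder R]
  [AddLeftMono R] [AddRightMono R]

/-- If `e` were the least positive element, the set of all `y + y` would contain no two
consecutive elements, although it is infinite and definable. -/
theorem IsOMinimal.denselyOrdered (H : IsOMinimal L R) (hadd : ExpandsAdd L R) [Nontrivial R] :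
    DenselyOrdered R := by
  have := noMaxOrder_of_nontrivial (R := R)
  refine ⟨fun a b hab => ?_⟩
  by_contra! hgap
  obtain ⟨e, he, hmin⟩ : ∃ e : R, 0 < e ∧ ∀ x, 0 < x → e ≤ x := by
    refine ⟨b - a, sub_pos.2 hab, fun x hx => ?_⟩
    rw [sub_le_iff_le_add]
    exact hgap _ (lt_add_of_pos_left a hx)
  have hdef : (univ : Set R).Definable₁ L (range fun y : R => y + y) := by
    refine definable_exists (P := fun (v : Fin 1 → R) y => y + y = v 0) ?_
    exact (definableFun_add hadd (.proj L) (.proj L)).ofPred_eq (.proj L)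
  have hmono : StrictMono fun y : R => y + y := fun y z hyz => add_lt_add hyz hyz
  obtain ⟨p, q, hpq, hsub⟩ :=
    H.exists_Icc_subset hdef (infinite_range_of_injective hmono.injective)
  have hle : p + e ≤ q := by
    have := hmin (-p + q) (by rwa [lt_neg_add_iff_add_lt, add_zero])
    rwa [le_neg_add_iff_add_le] at this
  obtain ⟨y, hy⟩ := hsub (left_mem_Icc.2 hpq.le)
  obtain ⟨z, hz⟩ := hsub ⟨le_add_of_nonneg_right he.le, hle⟩
  simp only at hy hz
  have hyz : y < z := hmono.lt_iff_lt.1 (by simpa only [hy, hz] using lt_add_of_pos_right p he)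
  have h1 : e + y ≤ z := by
    have := hmin (z - y) (sub_pos.2 hyz)
    rwa [le_sub_iff_add_le] at this
  have h2 : y + e ≤ z := by
    have := hmin (-y + z) (by rwa [lt_neg_add_iff_add_lt, add_zero])
    rwa [le_neg_add_iff_add_le] at this
  have h3 : e + (p + e) ≤ p + e := by
    calc e + (p + e) = (e + y) + (y + e) := by rw [← hy]; simp only [add_assoc]
      _ ≤ z + z := add_le_add h1 h2
      _ = p + e := hz
  exact (lt_add_of_pos_left (p + e) he).not_ge h3

/-- By definable completeness, a nonempty definable initial segment of the positive elements that
is closed under addition has no supremum, hence contains every positive element. -/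
theorem IsOMinimal.mem_of_initial_segment (H : IsOMinimal L R) (hadd : ExpandsAdd L R)
    [Nontrivial R] {C : Set R} (hC : (univ : Set R).Definable₁ L C) (hne : C.Nonempty)
    (hpos : ∀ x ∈ C, 0 < x) (hinit : ∀ x ∈ C, ∀ y, 0 < y → y ≤ x → y ∈ C)
    (hclosed : ∀ x ∈ C, ∀ y ∈ C, x + y ∈ C) {b : R} (hb : 0 < b) : b ∈ C := by
  have := noMaxOrder_of_nontrivial (R := R)
  have := H.denselyOrdered hadd
  by_contra hbC
  have hbdd : BddAbove C :=
    ⟨b, fun x hx => le_of_not_ge fun hbx => hbC (hinit x hx b hb hbx)⟩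
  obtain ⟨s, hs⟩ := H.exists_isLUB hC hne hbdd
  obtain ⟨e, he⟩ := hne
  obtain ⟨x, hx, hsx⟩ := (lt_isLUB_iff hs).1 (sub_lt_self s (hpos e he))
  exact (sub_lt_iff_lt_add.1 hsx).not_ge (hs.1 (hclosed x hx e he))

/-- A nonzero definable subgroup of an o-minimal ordered group is the whole group. -/
theorem IsOMinimal.addSubgroup_eq_top (H : IsOMinimal L R) (hadd : ExpandsAdd L R)
    {G : AddSubgroup R} (hG : (univ : Set R).Definable₁ L (G : Set R)) {a : R} (ha : a ∈ G)
    (ha0 : a ≠ 0) : G = ⊤ := by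
  have : Nontrivial R := ⟨a, 0, ha0⟩
  obtain ⟨c, hc, hc0⟩ : ∃ c ∈ G, 0 < c := by
    rcases ha0.lt_or_gt with h | h
    · exact ⟨-a, neg_mem ha, neg_pos.2 h⟩
    · exact ⟨a, ha, h⟩
  have hinf : (G : Set R).Infinite := fun hfin => by
    obtain ⟨m, hm, hmax⟩ := Set.exists_max_image _ id hfin ⟨0, zero_mem G⟩
    exact (hmax (m + c) (add_mem hm hc)).not_gt (lt_add_of_pos_right m hc0)
  obtain ⟨p, q, hpq, hsub⟩ := H.exists_Icc_subset hG hinf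
  have hall : ∀ {b : R}, 0 < b → 0 < b ∧ ∀ y, 0 < y → y ≤ b → y ∈ G := by
    refine H.mem_of_initial_segment hadd (C := {x | 0 < x ∧ ∀ y, 0 < y → y ≤ x → y ∈ G}) ?_
      ⟨q - p, sub_pos.2 hpq, fun y hy hyq => ?_⟩
      (fun x hx => hx.1) (fun x hx y hy hyx => ⟨hy, fun z hz hzy => hx.2 z hz (hzy.trans hyx)⟩)
      fun x hx y hy => ⟨add_pos hx.1 hy.1, fun z hz hzxy => ?_⟩
    · have h0 : (univ : Set R).DefinableFun L fun _ : Fin 1 → R => (0 : R) := definableFun_const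
      refine definable_and (definable_lt H.expandsLT h0 (.proj L)) (definable_forall ?_)
      refine definable_imp (definable_lt H.expandsLT definableFun_const (.proj L)) ?_
      exact definable_imp (definable_le H.expandsLT (.proj L) (.proj L))
        (definable_mem hG (.proj L))
    · have h1 : y + p ∈ G :=
        hsub ⟨le_add_of_nonneg_left hy.le, le_sub_iff_add_le.1 hyq⟩
      simpa using sub_mem h1 (hsub (left_mem_Icc.2 hpq.le))
    · rcases le_or_gt z x with hzx | hxz
      · exact hx.2 z hz hzx
      · have h1 : -x + z ∈ G := hy.2 _ (by rwa [lt_neg_add_iff_add_lt, add_zero])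
          (by rwa [neg_add_le_iff_le_add])
        simpa using add_mem (hx.2 x hx.1 le_rfl) h1
  refine eq_top_iff.2 fun x _ => ?_
  rcases lt_trichotomy x 0 with h | rfl | h
  · have := (hall (neg_pos.2 h)).2 _ (neg_pos.2 h) le_rfl
    simpa using neg_mem this
  · exact zero_mem G
  · exact (hall h).2 x h le_rfl

/-- The centralizer of a nonzero element is a nonzero definable subgroup, so an o-minimal ordered
group is commutative. -/
theorem IsOMinimal.add_comm (H : IsOMinimal L R) (hadd : ExpandsAdd L R) (a b : R) :
    a + b = b + a := by
  rcases eq_or_ne a 0 with rfl | ha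
  · simp
  have hdef : (univ : Set R).Definable₁ L (AddSubgroup.centralizer {a} : Set R) := by
    have := (definableFun_add (α := Fin 1) (A := univ) hadd (.proj L (i := 0))
      (definableFun_const (a := a))).ofPred_eq
      (definableFun_add hadd (definableFun_const (a := a)) (.proj L (i := 0)))
    simpa only [Definable₁, SetLike.mem_coe, AddSubgroup.mem_centralizer_singleton_iff] using this
  have htop := H.addSubgroup_eq_top hadd hdef
    (AddSubgroup.mem_centralizer_singleton_iff.2 rfl) ha
  have hb : b ∈ AddSubgroup.centralizer {a} := htop ▸ AddSubgroup.mem_top b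
  exact (AddSubgroup.mem_centralizer_singleton_iff.1 hb).symm

end AddGroup

/-! ### Definable endomorphisms of o-minimal ordered groups -/

theorem EndDefinable.sub {L : Language} {R : Type*} [L.Structure R] [AddCommGroup R]
    (hadd : ExpandsAdd L R) {f g : R →+ R} (hf : EndDefinable L univ f)
    (hg : EndDefinable L univ g) : EndDefinable L univ (f - g) :=
  (definableFun_sub hadd (hf.comp (.proj L)) (hg.comp (.proj L))).ofPred_eq
    (.proj L (i := (1 : Fin 2)))

section AddCommGroup

variable {L : Language} {R : Type*} [L.Structure R] [AddCommGroup R] [LinearOrder R]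
  [IsOrderedAddMonoid R]

theorem EndDefinable.eq_of_apply_eq (H : IsOMinimal L R) (hadd : ExpandsAdd L R) {f g : R →+ R}
    (hf : EndDefinable L univ f) (hg : EndDefinable L univ g) {c : R} (hc : c ≠ 0)
    (h : f c = g c) : f = g := by
  have hdef : (univ : Set R).Definable₁ L (f.eqLocus g : Set R) :=
    (hf.comp (.proj L (i := 0))).ofPred_eq (hg.comp (.proj L (i := 0)))
  have htop := H.addSubgroup_eq_top hadd hdef (a := c) h hc
  ext x
  have hx : x ∈ f.eqLocus g := htop ▸ AddSubgroup.mem_top x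
  exact hx

theorem EndDefinable.surjective (H : IsOMinimal L R) (hadd : ExpandsAdd L R) {f : R →+ R}
    (hf : EndDefinable L univ f) {c : R} (hc : f c ≠ 0) : Function.Surjective f := by
  have hdef : (univ : Set R).Definable₁ L (f.range : Set R) :=
    definable_exists (P := fun (v : Fin 1 → R) x => f x = v 0)
      ((hf.comp (.proj L)).ofPred_eq (.proj L))
  exact AddMonoidHom.range_eq_top.1 (H.addSubgroup_eq_top hadd hdef (a := f c) ⟨c, rfl⟩ hc)

/-- The sign of a definable endomorphism is constant immediately to the right of `0`, and then, by
additivity, on all positive elements. -/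
theorem EndDefinable.strictMono (H : IsOMinimal L R) (hadd : ExpandsAdd L R) {f : R →+ R}
    (hf : EndDefinable L univ f) {c : R} (hc : 0 < c) (hfc : 0 < f c) : StrictMono f := by
  have : Nontrivial R := ⟨c, 0, hc.ne'⟩
  have := H.denselyOrdered hadd
  have hdef : (univ : Set R).Definable₁ L {x | 0 < f x} :=
    definable_lt H.expandsLT definableFun_const (hf.comp (.proj L (i := 0)))
  obtain ⟨e, he, hpos⟩ := H.exists_Ioo_subset_or_disjoint hdef 0
  obtain ⟨d, hd, hde⟩ := exists_between he
  -- Applied to the positive and to the nonpositive elements as `s`.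
  have key : ∀ s : Set R, (univ : Set R).Definable₁ L s → (∀ x ∈ s, ∀ y ∈ s, x + y ∈ s) →
      (∀ x, 0 < x → x < e → f x ∈ s) → ∀ x, 0 < x → f x ∈ s := by
    intro s hs hadds hes x hx
    suffices h : x ∈ {x | 0 < x ∧ ∀ y, 0 < y → y ≤ x → f y ∈ s} from h.2 x hx le_rfl
    refine H.mem_of_initial_segment hadd (C := {x | 0 < x ∧ ∀ y, 0 < y → y ≤ x → f y ∈ s}) ?_
      ⟨d, hd, fun y hy hyd => hes y hy (hyd.trans_lt hde)⟩ (fun x hx => hx.1)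
      (fun x hx y hy hyx => ⟨hy, fun z hz hzy => hx.2 z hz (hzy.trans hyx)⟩)
      (fun x hx y hy => ⟨add_pos hx.1 hy.1, fun z hz hzxy => ?_⟩) hx
    · refine definable_and (definable_lt H.expandsLT definableFun_const (.proj L (i := 0)))
        (definable_forall ?_)
      refine definable_imp (definable_lt H.expandsLT definableFun_const (.proj L)) ?_
      exact definable_imp (definable_le H.expandsLT (.proj L) (.proj L))
        (definable_mem hs (hf.comp (.proj L)))
    · rcases le_or_gt z x with hzx | hxz
      · exact hx.2 z hz hzx
      · have h := hadds _ (hx.2 x hx.1 le_rfl) _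
          (hy.2 (z - x) (sub_pos.2 hxz) (sub_le_iff_le_add'.2 hzxy))
        rwa [← map_add, add_sub_cancel] at h
  rcases hpos with hpos | hneg
  · have h0 : (univ : Set R).Definable₁ L (Ioi 0) :=
      definable_lt H.expandsLT definableFun_const (.proj L (i := 0))
    have h := key _ h0 (fun x hx y hy => add_pos hx hy) fun x hx hxe => hpos ⟨hx, hxe⟩
    intro x y hxy
    have := h _ (sub_pos.2 hxy)
    rwa [map_sub, mem_Ioi, sub_pos] at this
  · have h0 : (univ : Set R).Definable₁ L (Iic 0) :=
      definable_le H.expandsLT (.proj L (i := 0)) definableFun_const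
    have h := key _ h0 (fun x hx y hy => add_nonpos hx hy) fun x hx hxe =>
      not_lt.1 fun hlt => hneg.notMem_of_mem_left ⟨hx, hxe⟩ hlt
    exact ((h c hc).not_gt hfc).elim

end AddCommGroup

/-! ### Algebraic closure of the empty set -/

section Acl

variable {L : Language} {R : Type*} [L.Structure R]

theorem sub_mem_acl [AddCommGroup R] (hadd : ExpandsAdd L R) {a b : R} (ha : a ∈ acl L (∅ : Set R))
    (hb : b ∈ acl L (∅ : Set R)) : a - b ∈ acl L (∅ : Set R) := by
  obtain ⟨X, hX, hXd, haX⟩ := ha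
  obtain ⟨Y, hY, hYd, hbY⟩ := hb
  refine ⟨image2 (· - ·) X Y, hX.image2 _ hY, ?_, mem_image2_of_mem haX hbY⟩
  refine definable_exists (P := fun (v : Fin 1 → R) x => x ∈ X ∧ ∃ y, y ∈ Y ∧ x - y = v 0) ?_
  refine definable_and (definable_mem hXd (.proj L)) (definable_exists ?_)
  exact definable_and (definable_mem hYd (.proj L))
    ((definableFun_sub hadd (.proj L) (.proj L)).ofPred_eq (.proj L))

theorem add_mem_acl [AddCommGroup R] (hadd : ExpandsAdd L R) {a b : R} (ha : a ∈ acl L (∅ : Set R))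
    (hb : b ∈ acl L (∅ : Set R)) : a + b ∈ acl L (∅ : Set R) := by
  have h := sub_mem_acl hadd ha (sub_mem_acl hadd (sub_mem_acl hadd hb hb) hb)
  simpa using h

/-- If a definable relation agrees with `<` on a finite definable set, the elements of that set
can be defined one after the other, as successive minima. -/
theorem definable_singleton_of_finite [LinearOrder R] {r : Set (R × R)} {A : Set R}
    (hr : A.Definable₂ L r) {X : Set R} (hX : X.Finite)
    (hXd : A.Definable₁ L X) (hrX : ∀ x ∈ X, ∀ y ∈ X, (x, y) ∈ r ↔ x < y) {a : R} (ha : a ∈ X) :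
    A.Definable₁ L {a} := by
  induction hn : X.ncard using Nat.strong_induction_on generalizing X with
  | _ n ih =>
    obtain ⟨m, hm, hmin⟩ := X.exists_min_image id hX ⟨a, ha⟩
    have hmd : A.Definable₁ L {m} := by
      have heq : ({m} : Set R) = {x | x ∈ X ∧ ∀ y, y ∈ X → (y, x) ∉ r} := by
        ext x
        refine ⟨?_, fun ⟨hx, hxr⟩ => ?_⟩
        · rintro rfl
          exact ⟨hm, fun y hy hyr => ((hrX y hy x hm).1 hyr).not_ge (hmin y hy)⟩
        · exact le_antisymm (le_of_not_gt fun h => hxr m hm ((hrX m hm x hx).2 h)) (hmin x hx)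
      rw [heq]
      refine definable_and (definable_mem hXd (.proj L (i := 0))) (definable_forall ?_)
      exact definable_imp (definable_mem hXd (.proj L))
        (definable_not (definable_mem_pair hr (.proj L) (.proj L)))
    rcases eq_or_ne a m with rfl | ham
    · exact hmd
    · exact ih _ (hn ▸ ncard_sdiff_singleton_lt_of_mem hm hX) (hX.sdiff (t := {m}))
        (definable_and (definable_mem hXd (.proj L (i := 0)))
          (definable_not (definable_mem hmd (.proj L (i := 0)))))
        (fun x hx y hy => hrX x hx.1 y hy.1) ⟨ha, ham⟩ rfl

/-- Finite definable sets lie inside intervals on which the order is definable, so every algebraic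
element over `∅` is definable over `∅`. -/
theorem definable_singleton_of_mem_acl [AddCommGroup R] [LinearOrder R] [IsOrderedAddMonoid R]
    (hadd : ExpandsAdd L R)
    (hlt : OrderDefinableOnEmptyIntervals L R) {c : R} (hc : c ∈ acl L (∅ : Set R)) (hc0 : 0 < c)
    {a : R} (ha : a ∈ acl L (∅ : Set R)) : (∅ : Set R).Definable₁ L {a} := by
  obtain ⟨X, hX, hXd, haX⟩ := ha
  obtain ⟨m, hm, hmin⟩ := X.exists_min_image id hX ⟨a, haX⟩
  obtain ⟨M, hM, hmax⟩ := X.exists_max_image id hX ⟨a, haX⟩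
  have hsub : ∀ x ∈ X, x ∈ Ioo (m - c) (M + c) := fun x hx =>
    ⟨(sub_lt_self m hc0).trans_le (hmin x hx), (hmax x hx).trans_lt (lt_add_of_pos_right M hc0)⟩
  have hr := hlt _ (sub_mem_acl hadd ⟨X, hX, hXd, hm⟩ hc) _ (add_mem_acl hadd ⟨X, hX, hXd, hM⟩ hc)
  refine definable_singleton_of_finite hr hX hXd (fun x hx y hy => ?_) haX
  exact ⟨fun h => h.2.2, fun h => ⟨hsub x hx, hsub y hy, h⟩⟩

theorem definable_Ioo_of_acl [AddCommGroup R] [LinearOrder R] [DenselyOrdered R]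
    (hadd : ExpandsAdd L R) (hlt : OrderDefinableOnEmptyIntervals L R) {c : R}
    (hc : c ∈ acl L (∅ : Set R)) : (∅ : Set R).Definable₁ L (Ioo 0 c) := by
  have h0 : (0 : R) ∈ acl L (∅ : Set R) := by simpa using sub_mem_acl hadd hc hc
  have heq : Ioo 0 c = {x | ∃ y, (y, x) ∈
      {p : R × R | p.1 ∈ Ioo 0 c ∧ p.2 ∈ Ioo 0 c ∧ p.1 < p.2}} := by
    ext x
    refine ⟨fun hx => ?_, fun ⟨_, hy⟩ => hy.2.1⟩
    obtain ⟨y, hy0, hyx⟩ := exists_between hx.1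
    exact ⟨y, ⟨hy0, hyx.trans hx.2⟩, hx, hyx⟩
  rw [heq]
  exact definable_exists (definable_mem_pair (hlt 0 h0 c hc) (.proj L) (.proj L))

end Acl

/-! ### Definable families of endomorphisms -/

/-- Substitution of definable functions into the relation `Γ t x y` of a definable family. -/
theorem definable_family {L : Language} {R : Type*} [L.Structure R] {A : Set R} {α κ : Type*}
    [Finite κ] {Γ : (κ → R) → R → R → Prop}
    (hΓ : A.Definable L {z : κ ⊕ Fin 2 → R |
      Γ (fun i => z (.inl i)) (z (.inr 0)) (z (.inr 1))})
    {t : (α → R) → κ → R} (ht : ∀ i, A.DefinableFun L fun v => t v i) {F G : (α → R) → R}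
    (hF : A.DefinableFun L F) (hG : A.DefinableFun L G) :
    A.Definable L {v | Γ (t v) (F v) (G v)} := by
  refine Set.Definable.preimage_map (F := fun v => Sum.elim (t v) ![F v, G v]) (fun i => ?_) hΓ
  rcases i with i | i
  · exact ht i
  · fin_cases i <;> simpa

section Family

variable {Lomin L : Language} {R : Type*} [Lomin.Structure R] [L.Structure R]
  [AddCommGroup R] [LinearOrder R] [IsOrderedAddMonoid R]

/-- The elements `h⁻¹ c`, where `h` runs over the differences of members of the family with
`0 < h c < c`, are positive and form a set definable in the strongly bounded structure, so they are
bounded by some `K`. Hence distinct values `f t K` differ by at least `c`, as long as the values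
`f t c` lie in an interval of length less than `c`. If the family were infinite, o-minimality would
give an interval of values `f t c`, and the corresponding values `f t K` would form an infinite
definable set containing no interval. -/
theorem finite_range_of_definable_family (H : IsOMinimal Lomin R) (haddo : ExpandsAdd Lomin R)
    (hred : IsReduct L Lomin R) (hadd : ExpandsAdd L R) (hsb : IsStronglyBounded L R)
    {c : R} (hc : 0 < c) (hIoo : (univ : Set R).Definable₁ L (Ioo 0 c))
    {κ : Type*} [Finite κ] {T : Set (κ → R)} {f : T → (R →+ R)}
    (hf : (univ : Set R).Definable L {z : κ ⊕ Fin 2 → R |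
      ∃ h : (fun i => z (.inl i)) ∈ T, f ⟨_, h⟩ (z (.inr 0)) = z (.inr 1)}) :
    (range f).Finite := by
  have : Nontrivial R := ⟨c, 0, hc.ne'⟩
  have := H.denselyOrdered haddo
  let Γ : (κ → R) → R → R → Prop := fun t x y => ∃ h : t ∈ T, f ⟨t, h⟩ x = y
  have hΓo : (univ : Set R).Definable Lomin {z : κ ⊕ Fin 2 → R |
      Γ (fun i => z (.inl i)) (z (.inr 0)) (z (.inr 1))} := hred.definable hf
  have hend : ∀ t, EndDefinable Lomin univ (f t) := fun t => by
    have := definable_family (α := Fin 2) hΓo (t := fun _ => t) (fun i => definableFun_const)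
      (.proj Lomin (i := 0)) (.proj Lomin (i := 1))
    simpa only [EndDefinable, Definable₂, mem_ofPred_eq, Γ, t.2, exists_true_left] using this
  by_contra hinf
  have hDinf : {y | ∃ t, Γ t c y}.Infinite := by
    intro hfin
    refine hinf (Set.Finite.of_finite_image (f := fun g : R →+ R => g c)
      (hfin.subset ?_) ?_)
    · rintro _ ⟨_, ⟨t, rfl⟩, rfl⟩
      exact ⟨t, t.2, rfl⟩
    · rintro _ ⟨t, rfl⟩ _ ⟨s, rfl⟩ hts
      exact (hend t).eq_of_apply_eq H haddo (hend s) hc.ne' hts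
  have hDdef : (univ : Set R).Definable₁ Lomin {y | ∃ t, Γ t c y} :=
    definable_exists_tuple (definable_family hΓo (fun i => .proj Lomin) definableFun_const
      (.proj Lomin))
  obtain ⟨p, q', hpq', hsub⟩ := H.exists_Icc_subset hDdef hDinf
  obtain ⟨q, hpq, hq⟩ := exists_between (lt_min hpq' (lt_add_of_pos_right p hc))
  have hqc : q - p < c := sub_lt_iff_lt_add'.2 (hq.trans_le (min_le_right _ _))
  replace hsub : Icc p q ⊆ {y | ∃ t, Γ t c y} :=
    (Icc_subset_Icc_right (hq.le.trans (min_le_left _ _))).trans hsub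
  -- The set of preimages of `c` under small positive differences.
  let Y : Set R := {x | ∃ t s, ∃ a b a' b', Γ t c a ∧ Γ s c b ∧ a - b ∈ Ioo 0 c ∧
    Γ t x a' ∧ Γ s x b' ∧ a' - b' = c}
  have hYdef : (univ : Set R).Definable₁ L Y := by
    refine definable_exists_tuple (definable_exists_tuple ?_)
    refine definable_exists (definable_exists (definable_exists (definable_exists ?_)))
    refine definable_and (definable_family hf (fun i => .proj L) definableFun_const (.proj L)) ?_
    refine definable_and (definable_family hf (fun i => .proj L) definableFun_const (.proj L)) ?_
    refine definable_and (definable_mem hIoo (definableFun_sub hadd (.proj L) (.proj L))) ?_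
    refine definable_and (definable_family hf (fun i => .proj L) (.proj L) (.proj L)) ?_
    refine definable_and (definable_family hf (fun i => .proj L) (.proj L) (.proj L)) ?_
    exact (definableFun_sub hadd (.proj L) (.proj L)).ofPred_eq definableFun_const
  have hmono : ∀ t s, f t c - f s c ∈ Ioo 0 c → StrictMono (f t - f s) := fun t s h =>
    ((hend t).sub haddo (hend s)).strictMono H haddo hc h.1
  have hYpos : Y ⊆ Ioi 0 := by
    rintro x ⟨_, _, _, _, _, _, ⟨ht, rfl⟩, ⟨hs, rfl⟩, h, ⟨_, rfl⟩, ⟨_, rfl⟩, hx⟩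
    refine (hmono _ _ h).lt_iff_lt.1 ?_
    rw [map_zero]
    exact hc.trans_eq hx.symm
  have hYbdd : BddAbove Y := by
    rcases hsb Y hYdef with h | h
    · exact h.2
    · obtain ⟨m, hm⟩ := h.1
      obtain ⟨x, hx⟩ := exists_lt (min m 0)
      rw [lt_min_iff] at hx
      exact ((hm fun hxY => (hYpos hxY).not_gt hx.2).not_gt hx.1).elim
  obtain ⟨K₀, hK₀⟩ := hYbdd
  obtain ⟨K, hK, hKpos⟩ : ∃ K, K ∈ upperBounds Y ∧ 0 < K :=
    ⟨max K₀ c, fun x hx => (hK₀ hx).trans (le_max_left _ _), hc.trans_le (le_max_right _ _)⟩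
  have hsep : ∀ t s, f t c - f s c ∈ Ioo 0 c → c ≤ f t K - f s K := by
    intro t s h
    obtain ⟨x, hx⟩ := ((hend t).sub haddo (hend s)).surjective H haddo h.1.ne' c
    have hxY : x ∈ Y := ⟨t, s, _, _, _, _, ⟨t.2, rfl⟩, ⟨s.2, rfl⟩, h, ⟨t.2, rfl⟩, ⟨s.2, rfl⟩, hx⟩
    exact hx.symm.trans_le ((hmono t s h).monotone (hK hxY))
  let E : Set R := {y | ∃ t a, Γ t c a ∧ (p ≤ a ∧ a ≤ q) ∧ Γ t K y}
  have hEdef : (univ : Set R).Definable₁ Lomin E := by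
    refine definable_exists_tuple (definable_exists ?_)
    refine definable_and (definable_family hΓo (fun i => .proj Lomin) definableFun_const
      (.proj Lomin)) (definable_and (definable_and ?_ ?_) ?_)
    · exact definable_le H.expandsLT definableFun_const (.proj Lomin)
    · exact definable_le H.expandsLT (.proj Lomin) definableFun_const
    · exact definable_family hΓo (fun i => .proj Lomin) definableFun_const (.proj Lomin)
  have hEinf : E.Infinite := by
    have : Nonempty T := let ⟨t, ht, _⟩ := hsub (left_mem_Icc.2 hpq.le); ⟨⟨t, ht⟩⟩
    choose! τ hτ using fun a (ha : a ∈ Icc p q) =>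
      (show ∃ t : T, f t c = a from let ⟨t, ht, h⟩ := hsub ha; ⟨⟨t, ht⟩, h⟩)
    refine Set.infinite_of_injOn_mapsTo (f := fun a => f (τ a) K) (fun a ha b hb hab => ?_)
      (fun a ha => ⟨τ a, a, ⟨(τ a).2, hτ a ha⟩, ha, (τ a).2, rfl⟩) (Icc_infinite hpq)
    rw [← hτ a ha, ← hτ b hb, (hend (τ a)).eq_of_apply_eq H haddo (hend (τ b)) hKpos.ne' hab]
  obtain ⟨x, y, hxy, hE⟩ := H.exists_Icc_subset hEdef hEinf
  obtain ⟨z, hxz, hz⟩ := exists_between (lt_min hxy (lt_add_of_pos_right x hc))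
  have hzc : z - x < c := sub_lt_iff_lt_add'.2 (hz.trans_le (min_le_right _ _))
  obtain ⟨t, _, ⟨ht, rfl⟩, hta, ⟨_, rfl⟩⟩ := hE ⟨hxz.le, hz.le.trans (min_le_left _ _)⟩
  obtain ⟨s, _, ⟨hs, rfl⟩, hsa, ⟨_, rfl⟩⟩ := hE (left_mem_Icc.2 hxy.le)
  rcases lt_trichotomy (f ⟨t, ht⟩ c) (f ⟨s, hs⟩ c) with h | h | h
  · have := hsep ⟨s, hs⟩ ⟨t, ht⟩ ⟨sub_pos.2 h, (sub_le_sub hsa.2 hta.1).trans_lt hqc⟩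
    exact (sub_pos.1 (hc.trans_le this)).not_gt hxz
  · rw [(hend _).eq_of_apply_eq H haddo (hend _) hc.ne' h] at hxz
    exact hxz.false
  · have := hsep ⟨t, ht⟩ ⟨s, hs⟩ ⟨sub_pos.2 h, (sub_le_sub hta.2 hsa.1).trans_lt hqc⟩
    exact hzc.not_ge this

/-- A definable endomorphism belongs to a `∅`-definable family. The family is finite, so the value
of each member at the `∅`-definable element `c` is algebraic, hence definable, over `∅`; and this
value determines the member. -/
theorem EndDefinable.definable_empty (H : IsOMinimal Lomin R) (haddo : ExpandsAdd Lomin R)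
    (hred : IsReduct L Lomin R) (hadd : ExpandsAdd L R) (hsb : IsStronglyBounded L R)
    (hlt : OrderDefinableOnEmptyIntervals L R) {c : R} (hc : c ∈ acl L (∅ : Set R)) (hc0 : 0 < c)
    {f : R →+ R} (hf : EndDefinable L univ f) : EndDefinable L ∅ f := by
  have : Nontrivial R := ⟨c, 0, hc0.ne'⟩
  have := H.denselyOrdered haddo
  obtain ⟨A₀, -, hA₀⟩ := definable_iff_finitely_definable.1 hf
  obtain ⟨φ, hφ⟩ := definable_iff_exists_formula_sum.1 hA₀
  let Γ : (↥(A₀ : Set R) → R) → R → R → Prop := fun t x y => φ.Realize (Sum.elim t ![x, y])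
  have hΓ : (∅ : Set R).Definable L {z : ↥(A₀ : Set R) ⊕ Fin 2 → R |
      Γ (fun i => z (.inl i)) (z (.inr 0)) (z (.inr 1))} := by
    refine empty_definable_iff.2 ⟨φ, ?_⟩
    ext z
    suffices h : Sum.elim (fun i => z (.inl i)) ![z (.inr 0), z (.inr 1)] = z by
      simp only [Γ, mem_ofPred_eq, h]
    ext (i | i)
    · rfl
    · fin_cases i <;> rfl
  have hΓf : ∀ x y, Γ (fun i => i) x y ↔ f x = y := fun x y => by
    have := Set.ext_iff.1 hφ ![x, y]
    simpa [Γ] using this.symm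
  -- `P t` says that `Γ t` is the graph of an endomorphism.
  let P : (↥(A₀ : Set R) → R) → Prop := fun t => (∀ x, ∃ y, Γ t x y) ∧
    (∀ x y y', Γ t x y → Γ t x y' → y = y') ∧
    ∀ x x' y y', Γ t x y → Γ t x' y' → Γ t (x + x') (y + y')
  have hP : (∅ : Set R).Definable L {t | P t} := by
    refine definable_and (definable_forall (definable_exists ?_)) (definable_and
      (definable_forall (definable_forall (definable_forall ?_)))
      (definable_forall (definable_forall (definable_forall (definable_forall ?_)))))
    · exact definable_family hΓ (fun i => .proj L) (.proj L) (.proj L)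
    · exact definable_imp (definable_family hΓ (fun i => .proj L) (.proj L) (.proj L))
        (definable_imp (definable_family hΓ (fun i => .proj L) (.proj L) (.proj L))
          (DefinableFun.ofPred_eq (.proj L) (.proj L)))
    · exact definable_imp (definable_family hΓ (fun i => .proj L) (.proj L) (.proj L))
        (definable_imp (definable_family hΓ (fun i => .proj L) (.proj L) (.proj L))
          (definable_family hΓ (fun i => .proj L) (definableFun_add hadd (.proj L) (.proj L))
            (definableFun_add hadd (.proj L) (.proj L))))
  have hg : ∀ t : {t | P t}, ∃ g : R →+ R, ∀ x y, g x = y ↔ Γ t x y := by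
    rintro ⟨t, htot, huniq, haddΓ⟩
    choose g hg using fun x => htot x
    refine ⟨AddMonoidHom.mk' g fun x x' => huniq _ _ _ (hg _) (haddΓ _ _ _ _ (hg x) (hg x')),
      fun x y => ⟨?_, fun h => huniq _ _ _ (hg x) h⟩⟩
    rintro rfl
    exact hg x
  choose g hg using hg
  have hIoo := definable_Ioo_of_acl hadd hlt hc
  have hfin : (range g).Finite := by
    refine finite_range_of_definable_family H haddo hred hadd hsb hc0
      (hIoo.mono (empty_subset _)) ?_
    have h : (univ : Set R).Definable L {z : ↥(A₀ : Set R) ⊕ Fin 2 → R |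
        P (fun i => z (.inl i)) ∧ Γ (fun i => z (.inl i)) (z (.inr 0)) (z (.inr 1))} :=
      (definable_and (hP.preimage_comp Sum.inl) hΓ).mono (empty_subset _)
    convert h using 3 with z
    exact ⟨fun ⟨hz, h⟩ => ⟨hz, (hg ⟨_, hz⟩ _ _).1 h⟩, fun ⟨hz, h⟩ => ⟨hz, (hg ⟨_, hz⟩ _ _).2 h⟩⟩
  have hPf : P fun i => i := by
    refine ⟨fun x => ⟨f x, (hΓf _ _).2 rfl⟩, fun x y y' h h' => ?_, fun x x' y y' h h' => ?_⟩
    · exact ((hΓf _ _).1 h).symm.trans ((hΓf _ _).1 h')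
    · rw [hΓf] at h h' ⊢
      rw [map_add, h, h']
  have hcd : (∅ : Set R).Definable₁ L {c} := definable_singleton_of_mem_acl hadd hlt hc hc0 hc
  have hfc : (∅ : Set R).Definable₁ L {f c} := by
    refine definable_singleton_of_mem_acl hadd hlt hc hc0
      ⟨{y | ∃ t, ∃ u, u ∈ ({c} : Set R) ∧ P t ∧ Γ t u y}, ?_, ?_,
        ⟨_, c, rfl, hPf, (hΓf _ _).2 rfl⟩⟩
    · refine (hfin.image fun h => h c).subset ?_
      rintro y ⟨t, _, rfl, ht, hy⟩
      exact ⟨_, ⟨⟨t, ht⟩, rfl⟩, (hg ⟨t, ht⟩ _ _).2 hy⟩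
    · refine definable_exists_tuple (definable_exists ?_)
      refine definable_and (definable_mem hcd (.proj L)) (definable_and
        (hP.preimage_comp fun i => Sum.inl (Sum.inr i)) ?_)
      exact definable_family hΓ (fun i => .proj L) (.proj L) (.proj L)
  have hfo : EndDefinable Lomin univ f := hred.definable hf
  have heq : {p : R × R | f p.1 = p.2} = {p : R × R | ∃ t, ∃ u v, u ∈ ({c} : Set R) ∧
      v ∈ ({f c} : Set R) ∧ P t ∧ Γ t u v ∧ Γ t p.1 p.2} := by
    ext ⟨x, y⟩
    refine ⟨fun h => ⟨_, c, f c, rfl, rfl, hPf, (hΓf _ _).2 rfl, (hΓf _ _).2 h⟩, ?_⟩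
    rintro ⟨t, _, _, rfl, rfl, ht, htc, hxy⟩
    have hgo : EndDefinable Lomin univ (g ⟨t, ht⟩) := by
      have := definable_family (α := Fin 2) (hΓ.mono (empty_subset univ)) (t := fun _ => t)
        (fun i => definableFun_const) (.proj L (i := 0)) (.proj L (i := 1))
      refine hred.definable ?_
      simpa only [Definable₂, mem_ofPred_eq, hg] using this
    have := hgo.eq_of_apply_eq H haddo hfo hc0.ne' ((hg ⟨t, ht⟩ _ _).2 htc)
    exact this ▸ (hg ⟨t, ht⟩ _ _).2 hxy
  rw [EndDefinable, heq]
  refine definable_exists_tuple (definable_exists (definable_exists ?_))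
  refine definable_and (definable_mem hcd (.proj L)) (definable_and (definable_mem hfc (.proj L))
    (definable_and (hP.preimage_comp fun i => Sum.inl (Sum.inl (Sum.inr i))) (definable_and ?_ ?_)))
  · exact definable_family hΓ (fun i => .proj L) (.proj L) (.proj L)
  · exact definable_family hΓ (fun i => .proj L) (.proj L) (.proj L)

end Family

end StronglyBounded

theorem mainTheorem10 {R : Type*} [AddGroup R] [LinearOrder R] [AddLeftMono R] [AddRightMono R]
    (Lomin : FirstOrder.Language) [Lomin.Structure R]
    (L : FirstOrder.Language) [L.Structure R]
    (homin : StronglyBounded.IsOMinimal Lomin R)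
    (haddomin : StronglyBounded.ExpandsAdd Lomin R)
    (hred : StronglyBounded.IsReduct L Lomin R)
    (hadd : StronglyBounded.ExpandsAdd L R)
    (hsb : StronglyBounded.IsStronglyBounded L R)
    (hacl : ∃ c ∈ StronglyBounded.acl L (∅ : Set R), c ≠ 0)
    (hlt : StronglyBounded.OrderDefinableOnEmptyIntervals L R) :
    (∀ f : R →+ R, StronglyBounded.EndDefinable L Set.univ f →
      StronglyBounded.EndDefinable L ∅ f) ∧
    (∀ (k : ℕ) (T : Set (Fin k → R)) (f : T → (R →+ R)),
      StronglyBounded.EndFamilyDefinable L T f → (Set.range f).Finite) := by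
  let _ : AddCommGroup R :=
    { ‹AddGroup R› with add_comm := homin.add_comm haddomin }
  have : IsOrderedAddMonoid R := { add_le_add_left := fun a b h c => add_le_add_left h c }
  obtain ⟨c, hc, hc0⟩ : ∃ c ∈ StronglyBounded.acl L (∅ : Set R), 0 < c := by
    obtain ⟨c, hc, hne⟩ := hacl
    rcases hne.lt_or_gt with h | h
    · refine ⟨-c, ?_, neg_pos.2 h⟩
      simpa using StronglyBounded.sub_mem_acl hadd (StronglyBounded.sub_mem_acl hadd hc hc) hc
    · exact ⟨c, hc, h⟩
  have : Nontrivial R := ⟨c, 0, hc0.ne'⟩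
  have := homin.denselyOrdered haddomin
  refine ⟨fun f hf => hf.definable_empty homin haddomin hred hadd hsb hlt hc hc0,
    fun k T f hf => StronglyBounded.finite_range_of_definable_family homin haddomin hred hadd hsb
      hc0 ((StronglyBounded.definable_Ioo_of_acl hadd hlt hc).mono (Set.empty_subset _)) ?_⟩
  convert hf.2 using 3 with z
  constructor
  · rintro ⟨h, hz⟩
    exact ⟨⟨_, h⟩, fun _ => rfl, hz⟩
  · rintro ⟨t, ht, hz⟩
    obtain ⟨t, hT⟩ := t
    obtain rfl : (fun i => z (Sum.inl i)) = t := funext ht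
    exact ⟨hT, hz⟩
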